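/- Let $(\Omega,\Sigma,\mu)$ be a $\sigma$-finite measure space and let $\bar\varphi_0,\bar\varphi_1$ be two probability densities with respect to $\mu$ (for instance PDFs with respect to Lebesgue measure, or PMFs with respect to counting measure on a countable set) such that both Kullback–Leibler divergences $\int \bar\varphi_0\log\frac{\bar\varphi_0}{\bar\varphi_1}\,d\mu$ and $\int \bar\varphi_1\log\frac{\bar\varphi_1}{\bar\varphi_0}\,d\mu$ are positive and finite (so the two distributions are mutually absolutely continuous and distinct). Let $$D^*(\bar\varphi_0,\bar\varphi_1)=\sup_{\alpha\in(0,1)}\Big(-\log\int\bar\varphi_0^{1-\alpha}\bar\varphi_1^{\alpha}\,d\mu\Big)$$ be the Chernoff information. For $n\ge 1$ and $z\in\{0,1\}$ let $\varphi_z^{(n)}(x)=\prod_{j=1}^n\bar\varphi_z(x_j)$, a density on $\Omega^n$ with respect to $\mu^{\otimes n}$, and let $\eta(\varphi_0^{(n)},\varphi_1^{(n)})=\int_{\Omega^n}\min(\varphi_0^{(n)},\varphi_1^{(n)})\,d\mu^{\otimes n}$ be the total variation affinity. Then, as $n\to\infty$, $$\eta(\varphi_0^{(n)},\varphi_1^{(n)})=\Theta\Big(\frac1{\sqrt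 n}\,e^{-nD^*(\bar\varphi_0,\bar\varphi_1)}\Big),$$ with constants that may depend on $\bar\varphi_0,\bar\varphi_1$ and $\mu$. Consequently $$\log\eta(\varphi_0^{(n)},\varphi_1^{(n)})=-nD^*(\bar\varphi_0,\bar\varphi_1)-\tfrac12\log n+O(1),$$ and the same expansion holds for $\log R_n$, where $R_n=\frac12\sum_{z\in\{0,1\}}P_z^{(n)}(\hat z_n\neq z)$ is the Bayes error probability, $P_z^{(n)}$ being the distribution with density $\varphi_z^{(n)}$ and $\hat z_n$ any measurable selection $\hat z_n(x)\in\arg\max_{z\in\{0,1\}}\varphi_z^{(n)}(x)$. -/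

import Mathlib

open MeasureTheory Filter Asymptotics Set
open scoped ENNReal

noncomputable section

namespace BayesChernoff

variable {Ω : Type*} [MeasurableSpace Ω]

/-- `φ` is a probability density with respect to `μ` (a PDF if `μ` is Lebesgue measure, a PMF if
`μ` is counting measure). -/
structure IsDensity (μ : Measure Ω) (φ : Ω → ℝ) : Prop where
  measurable : Measurable φ
  nonneg : ∀ x, 0 ≤ φ x
  lintegral_eq_one : ∫⁻ x, ENNReal.ofReal (φ x) ∂μ = 1

/-- The distribution with density `φ` with respect to `μ`. -/
def law (μ : Measure Ω) (φ : Ω → ℝ) : Measure Ω :=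
  μ.withDensity fun x => ENNReal.ofReal (φ x)

/-- Pairs of densities whose Kullback–Leibler divergences in both directions are positive real
numbers. -/
structure IsAdmissible (μ : Measure Ω) (φ : Fin 2 → Ω → ℝ) : Prop where
  isDensity : ∀ z, IsDensity μ (φ z)
  kl_pos : 0 < InformationTheory.klDiv (law μ (φ 0)) (law μ (φ 1))
  kl_lt_top : InformationTheory.klDiv (law μ (φ 0)) (law μ (φ 1)) < ∞
  kl_pos' : 0 < InformationTheory.klDiv (law μ (φ 1)) (law μ (φ 0))
  kl_lt_top' : InformationTheory.klDiv (law μ (φ 1)) (law μ (φ 0)) < ∞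

/-- The `n`-fold product density `x ↦ ∏ j, φ (x j)`. -/
def iidDensity (n : ℕ) (φ : Ω → ℝ) (x : Fin n → Ω) : ℝ := ∏ j, φ (x j)

/-- The total variation affinity `η(φ₀, φ₁) = ∫ min(φ₀, φ₁) dμ`. -/
def affinity (μ : Measure Ω) (φ : Fin 2 → Ω → ℝ) : ℝ := ∫ x, min (φ 0 x) (φ 1 x) ∂μ

/-- The Chernoff `α`-divergence `-log ∫ φ₀^(1-α) φ₁^α dμ`. -/
def chernoffDiv (μ : Measure Ω) (φ : Fin 2 → Ω → ℝ) (α : ℝ) : ℝ :=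
  -Real.log (∫ x, φ 0 x ^ (1 - α) * φ 1 x ^ α ∂μ)

/-- The Chernoff information, the supremum over `α ∈ (0,1)` of the Chernoff `α`-divergence
(for an admissible pair this is a supremum of a nonempty bounded set). -/
def chernoffInfo (μ : Measure Ω) (φ : Fin 2 → Ω → ℝ) : ℝ :=
  ⨆ α : Ioo (0 : ℝ) 1, chernoffDiv μ φ α

/-- A Bayes estimator: a measurable choice of `argmax_z φ_z(x)` (ties broken arbitrarily). -/
def IsBayesEstimator (φ : Fin 2 → Ω → ℝ) (zhat : Ω → Fin 2) : Prop :=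
  Measurable zhat ∧ ∀ x z, φ z x ≤ φ (zhat x) x

/-- The error probability `R(ẑ, z) = ½ ∑_z P_z(ẑ ≠ z)` of an estimator `ẑ`. -/
def errorProb (μ : Measure Ω) (φ : Fin 2 → Ω → ℝ) (zhat : Ω → Fin 2) : ℝ :=
  1 / 2 * ∑ z, (law μ (φ z)).real {x | zhat x ≠ z}

end BayesChernoff

end

/-!
Let `α` minimise the Chernoff coefficient `∫ φ₀^(1-α) φ₁^α`, whose minimum is `exp (-D)` with `D`
the Chernoff information. Under the normalised geometric mixture at `α`, the log-likelihood ratio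
`X` is centred, because its mean is the logarithmic derivative of the coefficient, and it is not
a.e. zero. With `S n` the sum of `n` independent copies of `X` under this law, the affinity of the
product densities is exactly `exp (-n D)` times the expectation of
`min (exp (-α S n)) (exp ((1-α) S n))`, and it remains to see that this expectation is of order
`1 / √n`.

The last estimate holds for every continuous positive function of `S n` that is `O(1 / (1 + s²))`.
Such a function is sandwiched, up to constants, between two cosine transforms of compactly supported
weights, and the expectation of such a transform only involves the characteristic function of `X`
near `0`, where the central limit theorem controls its powers. As no other frequency matters,
lattice and non-lattice laws need not be told apart.
-/

open scoped Topology

namespace BayesChernoff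

section CosTransform

/-- The cosine transform of a weight supported on `[0, 1]`. Its integral against a law `ρ` is an
average of the characteristic function of `ρ` over a bounded set of frequencies. -/
noncomputable def cosTransform (w : ℝ → ℝ) (s : ℝ) : ℝ := ∫ u in (0 : ℝ)..1, w u * Real.cos (u * s)

lemma continuous_cosTransform {w : ℝ → ℝ} (hw : Continuous w) : Continuous (cosTransform w) :=
  intervalIntegral.continuous_parametric_intervalIntegral_of_continuous' (by fun_prop) 0 1

lemma abs_cosTransform_le {w : ℝ → ℝ} {B : ℝ} (hB : ∀ u ∈ Icc (0 : ℝ) 1, |w u| ≤ B) (s : ℝ) :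
    |cosTransform w s| ≤ B := by
  simpa [cosTransform] using intervalIntegral.norm_integral_le_of_norm_le_const (a := 0) (b := 1)
    (f := fun u => w u * Real.cos (u * s)) (C := B) fun u hu => by
      rw [uIoc_of_le zero_le_one] at hu
      rw [norm_mul]
      exact (mul_le_of_le_one_right (norm_nonneg _) (Real.abs_cos_le_one _)).trans
        (hB u (Ioc_subset_Icc_self hu))

lemma cosTransform_add {v w : ℝ → ℝ} (hv : Continuous v) (hw : Continuous w) (s : ℝ) :
    cosTransform (fun u => v u + w u) s = cosTransform v s + cosTransform w s := by
  simp only [cosTransform, add_mul]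
  exact intervalIntegral.integral_add (Continuous.intervalIntegrable (by fun_prop) 0 1)
    (Continuous.intervalIntegrable (by fun_prop) 0 1)

lemma integrable_cosTransform_mul (ρ : Measure ℝ) [IsFiniteMeasure ρ] {w : ℝ → ℝ}
    (hw : Continuous w) (δ : ℝ) : Integrable (fun s => cosTransform w (δ * s)) ρ := by
  obtain ⟨B, hB⟩ := isCompact_Icc.exists_bound_of_continuousOn hw.continuousOn
  exact .of_bound ((continuous_cosTransform hw).comp (by fun_prop)).aestronglyMeasurable B
    (ae_of_all _ fun s => abs_cosTransform_le hB _)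

lemma integral_cos_mul_eq_re_charFun (ρ : Measure ℝ) [IsFiniteMeasure ρ] (t : ℝ) :
    ∫ s, Real.cos (t * s) ∂ρ = (charFun ρ t).re := by
  have hint : Integrable (fun s : ℝ => Complex.exp (t * s * Complex.I)) ρ :=
    .of_bound (Continuous.aestronglyMeasurable (by fun_prop)) 1 (ae_of_all _ fun s => by
      rw [← Complex.ofReal_mul, Complex.norm_exp_ofReal_mul_I])
  rw [charFun_apply_real]
  refine Eq.trans ?_ (integral_re hint)
  simp only [← Complex.ofReal_mul, RCLike.re_to_complex, Complex.exp_ofReal_mul_I_re]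

lemma integral_cosTransform_mul (ρ : Measure ℝ) [IsFiniteMeasure ρ] {w : ℝ → ℝ}
    (hw : Continuous w) (δ : ℝ) :
    ∫ s, cosTransform w (δ * s) ∂ρ = ∫ u in (0 : ℝ)..1, w u * (charFun ρ (δ * u)).re := by
  have hint : Integrable (Function.uncurry fun u s : ℝ => w u * Real.cos (u * (δ * s)))
      ((volume.restrict (uIoc 0 1)).prod ρ) := by
    refine ((hw.integrableOn_uIcc.mono_set uIoc_subset_uIcc).mul_prod
      (integrable_const (1 : ℝ) (μ := ρ))).mono
      (Continuous.aestronglyMeasurable (by fun_prop)) (ae_of_all _ fun z => ?_)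
    simp only [Function.uncurry, norm_mul, mul_one]
    exact mul_le_of_le_one_right (norm_nonneg _) (Real.abs_cos_le_one _)
  simp only [cosTransform, ← integral_cos_mul_eq_re_charFun, ← integral_const_mul]
  rw [← intervalIntegral_integral_swap hint]
  simp only [mul_left_comm, mul_assoc]

lemma add_sq_mul_cosTransform {h h' : ℝ → ℝ} {κ : ℝ} (hh : ∀ u, HasDerivAt h (h' u) u)
    (hh' : ∀ u, HasDerivAt h' (κ * h u) u) (s : ℝ) :
    (κ + s ^ 2) * cosTransform h s = h' 1 * Real.cos s + s * h 1 * Real.sin s - h' 0 := by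
  have hcont : Continuous h := continuous_iff_continuousAt.2 fun u => (hh u).continuousAt
  have hderiv : ∀ u, HasDerivAt
      (fun u => h' u * Real.cos (u * s) + s * h u * Real.sin (u * s))
      ((κ + s ^ 2) * (h u * Real.cos (u * s))) u := fun u => by
    have hcos := (hasDerivAt_mul_const s (x := u)).cos
    have hsin := (hasDerivAt_mul_const s (x := u)).sin
    refine (((hh' u).fun_mul hcos).fun_add (((hh u).const_mul s).fun_mul hsin)).congr_deriv ?_
    ring
  rw [cosTransform, ← intervalIntegral.integral_const_mul,
    intervalIntegral.integral_eq_sub_of_hasDerivAt (fun u _ => hderiv u)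
      (Continuous.intervalIntegrable (by fun_prop) 0 1)]
  simp

lemma one_add_sq_mul_cosTransform_sinh (s : ℝ) :
    (1 + s ^ 2) * cosTransform (fun u => Real.sinh (1 - u)) s = Real.cosh 1 - Real.cos s := by
  have hsub : ∀ u : ℝ, HasDerivAt (fun u => 1 - u) (-1) u := fun u => by
    simpa using (hasDerivAt_id u).const_sub 1
  rw [add_sq_mul_cosTransform (h' := fun u => -Real.cosh (1 - u))
    (fun u => by simpa using (hsub u).sinh) fun u => by simpa using (hsub u).cosh.fun_neg]
  simp only [sub_self, Real.cosh_zero, neg_mul, one_mul, Real.sinh_zero, mul_zero, zero_mul,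
    add_zero, sub_zero, sub_neg_eq_add]
  ring

lemma sq_mul_cosTransform_triangle (s : ℝ) :
    s ^ 2 * cosTransform (fun u => 1 - u) s = 1 - Real.cos s := by
  have h := add_sq_mul_cosTransform (h := fun u => 1 - u) (h' := fun _ => -1) (κ := 0)
    (fun u => by simpa using (hasDerivAt_id u).const_sub 1)
    (fun u => by simpa using hasDerivAt_const u (-1 : ℝ)) s
  simp only [zero_add, neg_mul, one_mul, sub_self, mul_zero, zero_mul, add_zero,
    sub_neg_eq_add] at h
  rw [h]; ring

lemma sq_sub_mul_cosTransform_sin (s : ℝ) :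
    (s ^ 2 - (2 * Real.pi) ^ 2)
        * cosTransform (fun u => Real.sin (2 * Real.pi * u) / (2 * Real.pi)) s
      = Real.cos s - 1 := by
  have hlin : ∀ u : ℝ, HasDerivAt (fun u => 2 * Real.pi * u) (2 * Real.pi) u := fun u => by
    simpa using (hasDerivAt_id u).const_mul (2 * Real.pi)
  have h := add_sq_mul_cosTransform (h := fun u => Real.sin (2 * Real.pi * u) / (2 * Real.pi))
    (h' := fun u => Real.cos (2 * Real.pi * u)) (κ := -(2 * Real.pi) ^ 2)
    (fun u => ((hlin u).sin.div_const (2 * Real.pi)).congr_deriv (by field_simp))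
    (fun u => (hlin u).cos.congr_deriv (by field_simp)) s
  simp only [neg_add_eq_sub, mul_one, Real.cos_two_pi, one_mul, Real.sin_two_pi, zero_div,
    mul_zero, zero_mul, add_zero, Real.cos_zero] at h
  rw [h]

/-- The weight of a minorant of Selberg type: its cosine transform is nonpositive outside
`[-2π, 2π]`. -/
noncomputable def selbergWeight (u : ℝ) : ℝ := 1 - u + Real.sin (2 * Real.pi * u) / (2 * Real.pi)

lemma continuous_selbergWeight : Continuous selbergWeight := by
  unfold selbergWeight
  fun_prop

lemma abs_selbergWeight_le {u : ℝ} (hu : u ∈ Icc (0 : ℝ) 1) : |selbergWeight u| ≤ 2 := by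
  have hsin : |Real.sin (2 * Real.pi * u) / (2 * Real.pi)| ≤ 1 := by
    rw [abs_div, abs_of_pos Real.two_pi_pos]
    exact div_le_one_of_le₀
      ((Real.abs_sin_le_one _).trans (by linarith [Real.pi_gt_three])) Real.two_pi_pos.le
  calc |selbergWeight u| ≤ |1 - u| + |Real.sin (2 * Real.pi * u) / (2 * Real.pi)| :=
        abs_add_le _ _
    _ ≤ 1 + 1 := add_le_add (abs_le.2 ⟨by linarith [hu.2], by linarith [hu.1]⟩) hsin
    _ = 2 := by norm_num

lemma cosTransform_selbergWeight_nonpos {s : ℝ} (hs : 2 * Real.pi < |s|) :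
    cosTransform selbergWeight s ≤ 0 := by
  have hd : 0 < s ^ 2 - (2 * Real.pi) ^ 2 := by
    rw [sub_pos, ← sq_abs s]
    exact pow_lt_pow_left₀ hs Real.two_pi_pos.le two_ne_zero
  have hs2 : 0 < s ^ 2 := hd.trans_le (sub_le_self _ (sq_nonneg _))
  have hsum : cosTransform selbergWeight s
      = (1 - Real.cos s) / s ^ 2 - (1 - Real.cos s) / (s ^ 2 - (2 * Real.pi) ^ 2) := by
    rw [sub_eq_add_neg, ← neg_div, neg_sub, ← sq_mul_cosTransform_triangle,
      ← sq_sub_mul_cosTransform_sin, mul_div_cancel_left₀ _ hs2.ne', mul_div_cancel_left₀ _ hd.ne']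
    exact cosTransform_add (by fun_prop) (by fun_prop) s
  rw [hsum, sub_nonpos]
  exact div_le_div_of_nonneg_left (sub_nonneg.2 (Real.cos_le_one s)) hd
    (sub_le_self _ (sq_nonneg _))

lemma cosTransform_selbergWeight_le (s : ℝ) :
    cosTransform selbergWeight s
      ≤ (Icc (-(2 * Real.pi)) (2 * Real.pi)).indicator (fun _ => 2) s := by
  by_cases hs : s ∈ Icc (-(2 * Real.pi)) (2 * Real.pi)
  · rw [indicator_of_mem hs]
    exact (le_abs_self _).trans (abs_cosTransform_le (fun _ => abs_selbergWeight_le) s)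
  · rw [indicator_of_notMem hs]
    exact cosTransform_selbergWeight_nonpos (not_le.1 fun h => hs (abs_le.1 h))

end CosTransform

section LocalLimit

variable {ν : Measure ℝ}

lemma exists_norm_charFun_le_exp [IsProbabilityMeasure ν] (h0 : ∫ x, x ∂ν = 0)
    (h1 : ∫ x, x ^ 2 ∂ν = 1) :
    ∃ δ > 0, ∀ t, |t| ≤ δ → ‖charFun ν t‖ ≤ Real.exp (-t ^ 2 / 4) := by
  have htaylor := taylor_charFun_two (P := ν) (X := id) aemeasurable_id (by simpa using h0)
    (by simpa using h1)
  rw [Measure.map_id] at htaylor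
  obtain ⟨ε, hε, hb⟩ := Metric.eventually_nhds_iff.1
    (htaylor.bound (show (0 : ℝ) < 1 / 4 by norm_num))
  refine ⟨min (ε / 2) 1, by positivity, fun t ht => ?_⟩
  have hbt : ‖charFun ν t - (1 - t ^ 2 / 2)‖ ≤ 1 / 4 * t ^ 2 := by
    have htε : |t| < ε := (ht.trans (min_le_left _ _)).trans_lt (half_lt_self hε)
    simpa using hb (y := t) (by simpa using htε)
  have ht1 : t ^ 2 ≤ 1 := (sq_le_one_iff_abs_le_one t).2 (ht.trans (min_le_right _ _))
  have hnorm : ‖(1 : ℂ) - t ^ 2 / 2‖ = 1 - t ^ 2 / 2 := by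
    rw [show (1 : ℂ) - t ^ 2 / 2 = ((1 - t ^ 2 / 2 : ℝ) : ℂ) by push_cast; ring,
      Complex.norm_of_nonneg (by linarith)]
  calc ‖charFun ν t‖ ≤ ‖(1 : ℂ) - t ^ 2 / 2‖ + ‖charFun ν t - (1 - t ^ 2 / 2)‖ :=
        norm_le_norm_add_norm_sub' _ _
    _ ≤ (1 - t ^ 2 / 2) + 1 / 4 * t ^ 2 := by rw [hnorm]; gcongr
    _ = -t ^ 2 / 4 + 1 := by ring
    _ ≤ Real.exp (-t ^ 2 / 4) := Real.add_one_le_exp _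

lemma norm_charFun_inv_sqrt_mul_pow_le {δ : ℝ}
    (hδ : ∀ t, |t| ≤ δ → ‖charFun ν t‖ ≤ Real.exp (-t ^ 2 / 4)) {n : ℕ} {v : ℝ}
    (hv : v ∈ Ioc 0 (√n * δ)) :
    ‖charFun ν ((√n)⁻¹ * v) ^ n‖ ≤ Real.exp (-(1 / 4) * v ^ 2) := by
  have hn : 0 < √(n : ℝ) := (Real.sqrt_nonneg _).lt_of_ne fun h => by
    rw [← h, zero_mul] at hv
    exact hv.1.not_ge hv.2
  have hle : |(√n)⁻¹ * v| ≤ δ := by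
    rw [abs_of_pos (mul_pos (inv_pos.2 hn) hv.1), inv_mul_le_iff₀ hn]
    exact hv.2
  calc ‖charFun ν ((√n)⁻¹ * v) ^ n‖ ≤ Real.exp (-((√n)⁻¹ * v) ^ 2 / 4) ^ n := by
        rw [norm_pow]
        exact pow_le_pow_left₀ (norm_nonneg _) (hδ _ hle) n
    _ = Real.exp (√n ^ 2 * (-((√n)⁻¹ * v) ^ 2 / 4)) := by
        rw [← Real.exp_nat_mul, Real.sq_sqrt n.cast_nonneg]
    _ = Real.exp (-(1 / 4) * v ^ 2) := by
        congr 1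
        field_simp

/-- The integrand of `√n * ∫ u in 0..1, w u * Re (charFun ν (δ * u) ^ n)` after the substitution
`v = √n * δ * u`, up to the factor `δ`. -/
noncomputable def rescaledIntegrand (ν : Measure ℝ) (w : ℝ → ℝ) (δ : ℝ) (n : ℕ) : ℝ → ℝ :=
  (Ioc 0 (√n * δ)).indicator fun v => w ((√n * δ)⁻¹ * v) * (charFun ν ((√n)⁻¹ * v) ^ n).re

lemma integral_rescaledIntegrand (ν : Measure ℝ) (w : ℝ → ℝ) {δ : ℝ} (hδ : 0 < δ) {n : ℕ}
    (hn : 0 < n) :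
    δ⁻¹ * ∫ v in Ioi 0, rescaledIntegrand ν w δ n v
      = √n * ∫ u in (0 : ℝ)..1, w u * (charFun ν (δ * u) ^ n).re := by
  have hc : 0 < √(n : ℝ) := Real.sqrt_pos.2 (Nat.cast_pos.2 hn)
  have hsub := intervalIntegral.mul_integral_comp_mul_left (a := 0) (b := 1)
    (f := fun v => w ((√n * δ)⁻¹ * v) * (charFun ν ((√n)⁻¹ * v) ^ n).re) (c := √n * δ)
  have hfreq : ∀ u, (√(n : ℝ))⁻¹ * (√n * δ * u) = δ * u := fun u => by field_simp
  simp only [hfreq, mul_zero, mul_one, inv_mul_cancel_left₀ (mul_pos hc hδ).ne'] at hsub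
  rw [rescaledIntegrand, setIntegral_indicator measurableSet_Ioc,
    inter_eq_right.2 Ioc_subset_Ioi_self, ← intervalIntegral.integral_of_le (by positivity),
    ← hsub]
  field_simp

lemma norm_rescaledIntegrand_le {δ : ℝ}
    (hδ : ∀ t, |t| ≤ δ → ‖charFun ν t‖ ≤ Real.exp (-t ^ 2 / 4)) {w : ℝ → ℝ} {B : ℝ}
    (hB : ∀ u ∈ Icc (0 : ℝ) 1, |w u| ≤ B) (n : ℕ) (v : ℝ) :
    ‖rescaledIntegrand ν w δ n v‖ ≤ B * Real.exp (-(1 / 4) * v ^ 2) := by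
  have hB0 : 0 ≤ B := (abs_nonneg _).trans (hB 0 (left_mem_Icc.2 zero_le_one))
  by_cases hv : v ∈ Ioc 0 (√n * δ)
  · have hpos : 0 < √n * δ := hv.1.trans_le hv.2
    have hmem : (√n * δ)⁻¹ * v ∈ Icc (0 : ℝ) 1 :=
      ⟨mul_nonneg (inv_nonneg.2 hpos.le) hv.1.le, inv_mul_le_one_of_le₀ hv.2 hpos.le⟩
    rw [rescaledIntegrand, indicator_of_mem hv, norm_mul]
    exact mul_le_mul (hB _ hmem)
      ((Complex.abs_re_le_norm _).trans (norm_charFun_inv_sqrt_mul_pow_le hδ hv))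
      (norm_nonneg _) hB0
  · rw [rescaledIntegrand, indicator_of_notMem hv, norm_zero]
    positivity

lemma tendsto_sqrt_natCast_atTop : Tendsto (fun n : ℕ => √(n : ℝ)) atTop atTop :=
  Real.tendsto_sqrt_atTop.comp tendsto_natCast_atTop_atTop

lemma tendsto_rescaledIntegrand [IsProbabilityMeasure ν] (h0 : ∫ x, x ∂ν = 0)
    (h1 : ∫ x, x ^ 2 ∂ν = 1) {δ : ℝ} (hδ : 0 < δ) {w : ℝ → ℝ} (hw : Continuous w) {v : ℝ}
    (hv : 0 < v) :
    Tendsto (fun n => rescaledIntegrand ν w δ n v) atTop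
      (𝓝 (w 0 * Real.exp (-(1 / 2) * v ^ 2))) := by
  have hend := tendsto_sqrt_natCast_atTop.atTop_mul_const hδ
  have hw0 : Tendsto (fun n : ℕ => w ((√n * δ)⁻¹ * v)) atTop (𝓝 (w 0)) :=
    (hw.tendsto 0).comp (by simpa using (tendsto_inv_atTop_zero.comp hend).mul_const v)
  have hclt := ProbabilityTheory.tendsto_charFun_inv_sqrt_mul_pow (P := ν) (X := id)
    aemeasurable_id (by simpa using h0) (by simpa using h1) v
  rw [Measure.map_id, show (-(v : ℂ) ^ 2 / 2) = ((-(1 / 2) * v ^ 2 : ℝ) : ℂ) by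
    push_cast; ring, ← Complex.ofReal_exp] at hclt
  refine (hw0.mul ((Complex.continuous_re.tendsto _).comp hclt)).congr' ?_
  filter_upwards [hend.eventually_ge_atTop v] with n hn
  rw [rescaledIntegrand, indicator_of_mem (mem_Ioc.2 ⟨hv, hn⟩), Function.comp_apply]

lemma tendsto_sqrt_mul_integral_charFun_pow [IsProbabilityMeasure ν] (h0 : ∫ x, x ∂ν = 0)
    (h1 : ∫ x, x ^ 2 ∂ν = 1) {δ : ℝ} (hδ : 0 < δ)
    (hb : ∀ t, |t| ≤ δ → ‖charFun ν t‖ ≤ Real.exp (-t ^ 2 / 4)) {w : ℝ → ℝ} (hw : Continuous w) :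
    Tendsto (fun n : ℕ => √n * ∫ u in (0 : ℝ)..1, w u * (charFun ν (δ * u) ^ n).re) atTop
      (𝓝 (w 0 * (δ⁻¹ * (√(2 * Real.pi) / 2)))) := by
  obtain ⟨B, hB⟩ := isCompact_Icc.exists_bound_of_continuousOn (hw.continuousOn (s := Icc 0 1))
  have hgauss : ∫ v in Ioi (0 : ℝ), w 0 * Real.exp (-(1 / 2) * v ^ 2)
      = w 0 * (√(2 * Real.pi) / 2) := by
    rw [integral_const_mul, integral_gaussian_Ioi]
    congr 3
    ring
  have hmeas : ∀ n, AEStronglyMeasurable (rescaledIntegrand ν w δ n)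
      (volume.restrict (Ioi 0)) := fun n => by
    have : Continuous (charFun ν) := continuous_charFun
    exact (Continuous.aestronglyMeasurable (by fun_prop)).indicator measurableSet_Ioc
  rw [mul_left_comm, ← hgauss]
  refine (Tendsto.const_mul δ⁻¹ ?_).congr'
    ((eventually_gt_atTop 0).mono fun n => integral_rescaledIntegrand ν w hδ)
  exact tendsto_integral_of_dominated_convergence _ hmeas
    ((integrable_exp_neg_mul_sq (by norm_num : (0 : ℝ) < 1 / 4)).integrableOn.const_mul B)
    (fun n => ae_of_all _ (norm_rescaledIntegrand_le hb hB n))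
    ((ae_restrict_iff' measurableSet_Ioi).2
      (ae_of_all _ fun v hv => tendsto_rescaledIntegrand h0 h1 hδ hw hv))

variable [IsProbabilityMeasure ν] {ρ : ℕ → Measure ℝ} [∀ n, IsProbabilityMeasure (ρ n)]

lemma exists_tendsto_sqrt_mul_integral_cosTransform (h0 : ∫ x, x ∂ν = 0)
    (h2 : 0 < ∫ x, x ^ 2 ∂ν) (hρ : ∀ n t, charFun (ρ n) t = charFun ν t ^ n) :
    ∃ δ > 0, ∃ L > 0, ∀ w : ℝ → ℝ, Continuous w →
      Tendsto (fun n : ℕ => √n * ∫ s, cosTransform w (δ * s) ∂ρ n) atTop (𝓝 (w 0 * L)) := by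
  set σ := √(∫ x, x ^ 2 ∂ν)
  have : 0 < σ := Real.sqrt_pos.2 h2
  have hmap : AEMeasurable (fun x => σ⁻¹ * x) ν := by fun_prop
  have : IsProbabilityMeasure (ν.map fun x => σ⁻¹ * x) := Measure.isProbabilityMeasure_map hmap
  have hm0 : ∫ y, y ∂(ν.map fun x => σ⁻¹ * x) = 0 := by
    rw [integral_map hmap (by fun_prop), integral_const_mul, h0, mul_zero]
  have hm1 : ∫ y, y ^ 2 ∂(ν.map fun x => σ⁻¹ * x) = 1 := by
    rw [integral_map hmap (by fun_prop)]
    simp only [mul_pow]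
    rw [integral_const_mul, inv_pow, Real.sq_sqrt h2.le, inv_mul_cancel₀ h2.ne']
  obtain ⟨δ, hδ, hb⟩ := exists_norm_charFun_le_exp hm0 hm1
  refine ⟨δ / σ, by positivity, δ⁻¹ * (√(2 * Real.pi) / 2), by positivity, fun w hw => ?_⟩
  convert tendsto_sqrt_mul_integral_charFun_pow hm0 hm1 hδ hb hw using 4 with n
  rw [integral_cosTransform_mul _ hw]
  simp only [hρ, charFun_map_mul, div_eq_inv_mul, mul_assoc]

lemma inv_one_add_sq_le_cosTransform_sinh (δ s : ℝ) :
    (1 + s ^ 2)⁻¹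
      ≤ (1 + δ ^ 2) / (Real.cosh 1 - 1) * cosTransform (fun u => Real.sinh (1 - u)) (δ * s) := by
  have hcosh : 0 < Real.cosh 1 - 1 := sub_pos.2 (Real.one_lt_cosh.2 one_ne_zero)
  have hT : cosTransform (fun u => Real.sinh (1 - u)) (δ * s)
      = (Real.cosh 1 - Real.cos (δ * s)) / (1 + (δ * s) ^ 2) := by
    rw [← one_add_sq_mul_cosTransform_sinh, mul_div_cancel_left₀ _ (by positivity)]
  calc (1 + s ^ 2)⁻¹ ≤ (1 + δ ^ 2) / (1 + (δ * s) ^ 2) := by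
        rw [inv_eq_one_div, div_le_div_iff₀ (by positivity) (by positivity)]
        nlinarith [sq_nonneg δ, sq_nonneg s]
    _ = (1 + δ ^ 2) / (Real.cosh 1 - 1) * ((Real.cosh 1 - 1) / (1 + (δ * s) ^ 2)) := by
        field_simp
    _ ≤ _ := by
        rw [hT]
        gcongr
        exact Real.cos_le_one _

lemma integral_isBigO_inv_sqrt (h0 : ∫ x, x ∂ν = 0) (h2 : 0 < ∫ x, x ^ 2 ∂ν)
    (hρ : ∀ n t, charFun (ρ n) t = charFun ν t ^ n) {g : ℝ → ℝ}
    (hg : g =O[⊤] fun s => (1 + s ^ 2)⁻¹) :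
    (fun n => ∫ s, g s ∂ρ n) =O[atTop] fun n : ℕ => 1 / √(n : ℝ) := by
  obtain ⟨δ, -, L, -, hlim⟩ := exists_tendsto_sqrt_mul_integral_cosTransform h0 h2 hρ
  obtain ⟨A, hA, hgA⟩ := hg.exists_pos
  set W : ℝ → ℝ := fun u => Real.sinh (1 - u)
  have hW : Continuous W := by fun_prop
  set K := A * ((1 + δ ^ 2) / (Real.cosh 1 - 1))
  have hgW : ∀ s, ‖g s‖ ≤ K * cosTransform W (δ * s) := fun s => by
    have hgs := isBigOWith_top.1 hgA s
    rw [Real.norm_of_nonneg (by positivity : (0 : ℝ) ≤ (1 + s ^ 2)⁻¹)] at hgs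
    rw [mul_assoc]
    exact hgs.trans
      (mul_le_mul_of_nonneg_left (inv_one_add_sq_le_cosTransform_sinh δ s) hA.le)
  have hint : (fun n => ∫ s, g s ∂ρ n) =O[atTop] fun n => ∫ s, cosTransform W (δ * s) ∂ρ n :=
    .of_bound |K| (.of_forall fun n => by
      rw [← Real.norm_eq_abs, ← norm_mul, ← integral_const_mul]
      exact (norm_integral_le_of_norm_le ((integrable_cosTransform_mul (ρ n) hW δ).const_mul K)
        (ae_of_all _ hgW)).trans (Real.le_norm_self _))
  refine hint.trans (((isBigO_refl (fun n : ℕ => 1 / √(n : ℝ)) atTop).mul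
    ((hlim W hW).isBigO_one ℝ)).congr' ?_ (.of_eq (by simp)))
  filter_upwards [eventually_gt_atTop 0] with n hn
  have : 0 < √(n : ℝ) := Real.sqrt_pos.2 (Nat.cast_pos.2 hn)
  field_simp

lemma exists_inv_sqrt_isBigO_measureReal_Icc (h0 : ∫ x, x ∂ν = 0) (h2 : 0 < ∫ x, x ^ 2 ∂ν)
    (hρ : ∀ n t, charFun (ρ n) t = charFun ν t ^ n) :
    ∃ M, (fun n : ℕ => 1 / √(n : ℝ)) =O[atTop] fun n => (ρ n).real (Icc (-M) M) := by
  obtain ⟨δ, hδ, L, hL, hlim⟩ := exists_tendsto_sqrt_mul_integral_cosTransform h0 h2 hρ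
  set M := 2 * Real.pi / δ
  have hle : ∀ n, ∫ s, cosTransform selbergWeight (δ * s) ∂ρ n ≤ 2 * (ρ n).real (Icc (-M) M) :=
    fun n => by
    rw [mul_comm, ← smul_eq_mul, ← integral_indicator_const _ measurableSet_Icc]
    refine integral_mono (integrable_cosTransform_mul (ρ n) continuous_selbergWeight δ)
      ((integrable_const 2).indicator measurableSet_Icc) fun s => ?_
    have hmem : δ * s ∈ Icc (-(2 * Real.pi)) (2 * Real.pi) ↔ s ∈ Icc (-M) M := by
      rw [mem_Icc, mem_Icc, ← abs_le, ← abs_le, abs_mul, abs_of_pos hδ, le_div_iff₀ hδ, mul_comm]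
    simpa only [indicator, hmem] using cosTransform_selbergWeight_le (δ * s)
  have hlim' := hlim _ continuous_selbergWeight
  rw [show selbergWeight 0 = 1 by simp [selbergWeight], one_mul] at hlim'
  refine ⟨M, .of_bound (4 / L) ?_⟩
  filter_upwards [hlim'.eventually_const_le (half_lt_self hL), eventually_gt_atTop 0] with n hn hn0
  have hsqrt : 0 < √(n : ℝ) := Real.sqrt_pos.2 (Nat.cast_pos.2 hn0)
  have := hn.trans (mul_le_mul_of_nonneg_left (hle n) hsqrt.le)
  rw [Real.norm_of_nonneg (by positivity), Real.norm_of_nonneg measureReal_nonneg,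
    div_mul_eq_mul_div, div_le_div_iff₀ hsqrt hL]
  linarith

lemma inv_sqrt_isBigO_integral (h0 : ∫ x, x ∂ν = 0) (h2 : 0 < ∫ x, x ^ 2 ∂ν)
    (hρ : ∀ n t, charFun (ρ n) t = charFun ν t ^ n) {g : ℝ → ℝ} (hgc : Continuous g)
    (hgpos : ∀ s, 0 < g s) (hgi : ∀ n, Integrable g (ρ n)) :
    (fun n : ℕ => 1 / √(n : ℝ)) =O[atTop] fun n => ∫ s, g s ∂ρ n := by
  obtain ⟨M, hM⟩ := exists_inv_sqrt_isBigO_measureReal_Icc h0 h2 hρ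
  obtain ⟨m, hm, hgm⟩ := isCompact_Icc.exists_forall_le' (s := Icc (-M) M) hgc.continuousOn
    (a := 0) fun s _ => hgpos s
  refine hM.trans (.of_bound m⁻¹ (.of_forall fun n => ?_))
  rw [Real.norm_of_nonneg measureReal_nonneg,
    Real.norm_of_nonneg (integral_nonneg fun s => (hgpos s).le), le_inv_mul_iff₀ hm, mul_comm,
    ← smul_eq_mul, ← integral_indicator_const _ measurableSet_Icc]
  exact integral_mono ((integrable_const m).indicator measurableSet_Icc) (hgi n)
    (indicator_le' hgm fun s _ => (hgpos s).le)

lemma integral_isTheta_inv_sqrt (h0 : ∫ x, x ∂ν = 0) (h2 : 0 < ∫ x, x ^ 2 ∂ν)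
    (hρ : ∀ n t, charFun (ρ n) t = charFun ν t ^ n) {g : ℝ → ℝ} (hgc : Continuous g)
    (hgpos : ∀ s, 0 < g s) (hg : g =O[⊤] fun s => (1 + s ^ 2)⁻¹) :
    (fun n => ∫ s, g s ∂ρ n) =Θ[atTop] fun n : ℕ => 1 / √(n : ℝ) := by
  refine ⟨integral_isBigO_inv_sqrt h0 h2 hρ hg, inv_sqrt_isBigO_integral h0 h2 hρ hgc hgpos ?_⟩
  obtain ⟨A, hA, hgA⟩ := hg.exists_pos
  refine fun n => .of_bound hgc.aestronglyMeasurable A (ae_of_all _ fun s => ?_)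
  refine (isBigOWith_top.1 hgA s).trans (mul_le_of_le_one_right hA.le ?_)
  rw [Real.norm_of_nonneg (by positivity)]
  exact inv_le_one_of_one_le₀ (by linarith [sq_nonneg s])

end LocalLimit

section IndependentSums

variable {Ω : Type*} [MeasurableSpace Ω] {Q : Measure Ω} [IsProbabilityMeasure Q] {X : Ω → ℝ}

lemma charFun_map_sum_pi (hX : Measurable X) (n : ℕ) (t : ℝ) :
    charFun ((Measure.pi fun _ : Fin n => Q).map fun x => ∑ j, X (x j)) t
      = charFun (Q.map X) t ^ n := by
  have hindep : ProbabilityTheory.iIndepFun (fun (j : Fin n) x => X (x j))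
      (Measure.pi fun _ : Fin n => Q) :=
    ProbabilityTheory.iIndepFun_pi (X := fun _ : Fin n => X) fun _ => hX.aemeasurable
  have hmarginal : ∀ j : Fin n, (Measure.pi fun _ : Fin n => Q).map (fun x => X (x j)) = Q.map X :=
    fun j => (Measure.map_map hX (measurable_pi_apply j)).symm.trans
      (congrArg _ (measurePreserving_eval (fun _ : Fin n => Q) j).map_eq)
  have hmeas : ∀ j : Fin n, Measurable fun x : Fin n → Ω => X (x j) := fun j => by fun_prop
  rw [hindep.charFun_map_fun_sum_eq_prod fun j => (hmeas j).aemeasurable]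
  simp [hmarginal]

theorem integral_sum_pi_isTheta_inv_sqrt (hX : Measurable X) (h0 : ∫ x, X x ∂Q = 0)
    (h2 : 0 < ∫ x, X x ^ 2 ∂Q) {g : ℝ → ℝ} (hgc : Continuous g) (hgpos : ∀ s, 0 < g s)
    (hg : g =O[⊤] fun s => (1 + s ^ 2)⁻¹) :
    (fun n : ℕ => ∫ x, g (∑ j, X (x j)) ∂(Measure.pi fun _ : Fin n => Q))
      =Θ[atTop] fun n : ℕ => 1 / √(n : ℝ) := by
  have : IsProbabilityMeasure (Q.map X) := Measure.isProbabilityMeasure_map hX.aemeasurable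
  have hS : ∀ n, Measurable fun x : Fin n → Ω => ∑ j, X (x j) := fun n => by fun_prop
  have := fun n => Measure.isProbabilityMeasure_map (μ := Measure.pi fun _ : Fin n => Q)
    (hS n).aemeasurable
  have hmap : ∀ n, ∫ s, g s ∂((Measure.pi fun _ : Fin n => Q).map fun x => ∑ j, X (x j))
      = ∫ x, g (∑ j, X (x j)) ∂(Measure.pi fun _ : Fin n => Q) := fun n =>
    integral_map (hS n).aemeasurable hgc.aestronglyMeasurable
  simp only [← hmap]
  refine integral_isTheta_inv_sqrt ?_ ?_ (charFun_map_sum_pi hX) hgc hgpos hg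
  · rwa [integral_map hX.aemeasurable (by fun_prop)]
  · rwa [integral_map hX.aemeasurable (by fun_prop)]

end IndependentSums

section Densities

variable {Ω : Type*} {f g : Ω → ℝ} {φ : Fin 2 → Ω → ℝ}

lemma iidDensity_nonneg (hf : ∀ x, 0 ≤ f x) (n : ℕ) (x : Fin n → Ω) :
    0 ≤ iidDensity n f x :=
  Finset.prod_nonneg fun j _ => hf (x j)

lemma indicator_univ_pi_iidDensity {n : ℕ} (s : Fin n → Set Ω) (f : Ω → ℝ) (x : Fin n → Ω) :
    (univ.pi s).indicator (iidDensity n f) x = ∏ j, (s j).indicator f (x j) := by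
  by_cases hx : x ∈ univ.pi s
  · rw [indicator_of_mem hx]
    exact Finset.prod_congr rfl fun j _ => (indicator_of_mem (hx j trivial) f).symm
  · rw [indicator_of_notMem hx]
    obtain ⟨j, hj⟩ : ∃ j, x j ∉ s j := by simpa only [mem_univ_pi, not_forall] using hx
    exact (Finset.prod_eq_zero (Finset.mem_univ j) (indicator_of_notMem hj f)).symm

variable [MeasurableSpace Ω] {μ : Measure Ω}

lemma IsDensity.isProbabilityMeasure_law (hf : IsDensity μ f) : IsProbabilityMeasure (law μ f) :=
  ⟨by rw [law, withDensity_apply _ .univ, setLIntegral_univ, hf.lintegral_eq_one]⟩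

lemma IsDensity.integrable (hf : IsDensity μ f) : Integrable f μ := by
  refine ⟨hf.measurable.aestronglyMeasurable, ?_⟩
  rw [hasFiniteIntegral_iff_ofReal (ae_of_all _ hf.nonneg), hf.lintegral_eq_one]
  exact ENNReal.one_lt_top

lemma IsDensity.integral_eq_one (hf : IsDensity μ f) : ∫ x, f x ∂μ = 1 := by
  rw [integral_eq_lintegral_of_nonneg_ae (ae_of_all _ hf.nonneg)
    hf.measurable.aestronglyMeasurable, hf.lintegral_eq_one, ENNReal.toReal_one]

lemma isDensity_div_integral (hm : Measurable f) (h0 : ∀ x, 0 ≤ f x) (hint : Integrable f μ)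
    (hpos : 0 < ∫ x, f x ∂μ) : IsDensity μ fun x => f x / ∫ y, f y ∂μ where
  measurable := hm.div_const _
  nonneg x := div_nonneg (h0 x) hpos.le
  lintegral_eq_one := by
    rw [← ofReal_integral_eq_lintegral_ofReal (hint.div_const _)
      (ae_of_all _ fun x => div_nonneg (h0 x) hpos.le), integral_div, div_self hpos.ne',
      ENNReal.ofReal_one]

lemma law_congr_ae (h : f =ᵐ[μ] g) : law μ f = law μ g :=
  withDensity_congr_ae (h.fun_comp ENNReal.ofReal)

lemma integral_law (hf : Measurable f) (h0 : ∀ x, 0 ≤ f x) (g : Ω → ℝ) :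
    ∫ x, g x ∂(law μ f) = ∫ x, f x * g x ∂μ := by
  rw [law, integral_withDensity_eq_integral_toReal_smul (by fun_prop) (by simp)]
  simp only [ENNReal.toReal_ofReal (h0 _), smul_eq_mul]

lemma integrable_law_iff (hf : Measurable f) (h0 : ∀ x, 0 ≤ f x) :
    Integrable g (law μ f) ↔ Integrable (fun x => f x * g x) μ := by
  rw [law, integrable_withDensity_iff_integrable_smul' (by fun_prop) (by simp)]
  simp only [ENNReal.toReal_ofReal (h0 _), smul_eq_mul]

lemma measureReal_law (hf : Measurable f) (h0 : ∀ x, 0 ≤ f x) {s : Set Ω}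
    (hs : MeasurableSet s) : (law μ f).real s = ∫ x in s, f x ∂μ := by
  rw [measureReal_def, law, withDensity_apply _ hs,
    integral_eq_lintegral_of_nonneg_ae (ae_of_all _ h0) hf.aestronglyMeasurable]

lemma ae_eq_zero_imp_of_law_absolutelyContinuous (hf : Measurable f) (h0 : ∀ x, 0 ≤ f x)
    (hg : Measurable g) (h : law μ f ≪ law μ g) : ∀ᵐ x ∂μ, g x = 0 → f x = 0 := by
  have hg0 : ∀ᵐ x ∂law μ g, g x ≠ 0 :=
    (ae_withDensity_iff (by fun_prop)).2 (ae_of_all _ fun x hx h => hx (by simp [h]))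
  filter_upwards [(ae_withDensity_iff (by fun_prop)).1 (h.ae_le hg0)] with x hx hgx
  by_contra hfx
  exact hx (ENNReal.ofReal_pos.2 ((h0 x).lt_of_ne' hfx)).ne' hgx

lemma ae_eq_zero_iff_of_law_absolutelyContinuous (hm : ∀ z, Measurable (φ z))
    (h0 : ∀ z x, 0 ≤ φ z x) (h01 : law μ (φ 0) ≪ law μ (φ 1)) (h10 : law μ (φ 1) ≪ law μ (φ 0)) :
    ∀ᵐ x ∂μ, φ 0 x = 0 ↔ φ 1 x = 0 := by
  filter_upwards [ae_eq_zero_imp_of_law_absolutelyContinuous (hm 0) (h0 0) (hm 1) h01,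
    ae_eq_zero_imp_of_law_absolutelyContinuous (hm 1) (h0 1) (hm 0) h10] with x h h'
  exact ⟨h', h⟩

lemma IsAdmissible.law_ne (hφ : IsAdmissible μ φ) : law μ (φ 0) ≠ law μ (φ 1) := fun h => by
  have := (hφ.isDensity 1).isProbabilityMeasure_law
  have hpos := hφ.kl_pos
  rw [h, InformationTheory.klDiv_self] at hpos
  exact hpos.false

lemma measurable_iidDensity (hf : Measurable f) (n : ℕ) : Measurable (iidDensity n f) :=
  Finset.measurable_fun_prod _ fun j _ => hf.comp (measurable_pi_apply j)

lemma integrable_iidDensity [SigmaFinite μ] (hf : Integrable f μ) (n : ℕ) :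
    Integrable (iidDensity n f) (Measure.pi fun _ : Fin n => μ) :=
  Integrable.fintype_prod fun _ => hf

lemma pi_law [SigmaFinite μ] (hf : IsDensity μ f) (n : ℕ) :
    Measure.pi (fun _ : Fin n => law μ f)
      = law (Measure.pi fun _ : Fin n => μ) (iidDensity n f) := by
  have := hf.isProbabilityMeasure_law
  refine Measure.pi_eq fun s hs => ?_
  have hmarginal : ∀ j, law μ f (s j) = ENNReal.ofReal (∫ x, (s j).indicator f x ∂μ) := fun j => by
    rw [law, withDensity_apply _ (hs j), integral_indicator (hs j),
      ofReal_integral_eq_lintegral_ofReal hf.integrable.integrableOn (ae_of_all _ hf.nonneg)]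
  simp only [hmarginal]
  rw [← ENNReal.ofReal_prod_of_nonneg fun j _ =>
      integral_nonneg (indicator_nonneg fun x _ => hf.nonneg x),
    ← integral_fintype_prod_eq_prod (fun j => (s j).indicator f), law,
    withDensity_apply _ (.univ_pi hs),
    ← ofReal_integral_eq_lintegral_ofReal (integrable_iidDensity hf.integrable n).integrableOn
      (ae_of_all _ (iidDensity_nonneg hf.nonneg n)), ← integral_indicator (.univ_pi hs)]
  simp only [indicator_univ_pi_iidDensity]

lemma IsBayesEstimator.eq_min_of_ne {zhat : Ω → Fin 2} (hz : IsBayesEstimator φ zhat) {x : Ω}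
    {z : Fin 2} (hx : zhat x ≠ z) : φ z x = min (φ 0 x) (φ 1 x) := by
  have h := hz.2 x z
  generalize zhat x = w at *
  fin_cases z <;> fin_cases w <;> simp_all

lemma errorProb_eq_half_mul_affinity (hm : ∀ z, Measurable (φ z)) (h0 : ∀ z x, 0 ≤ φ z x)
    (hi : ∀ z, Integrable (φ z) μ) {zhat : Ω → Fin 2} (hz : IsBayesEstimator φ zhat) :
    errorProb μ φ zhat = 1 / 2 * affinity μ φ := by
  have hs : ∀ z, MeasurableSet {x | zhat x ≠ z} := fun z =>
    (hz.1 (measurableSet_singleton z)).compl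
  have herr : ∀ z, (law μ (φ z)).real {x | zhat x ≠ z}
      = ∫ x in {x | zhat x ≠ z}, min (φ 0 x) (φ 1 x) ∂μ := fun z => by
    rw [measureReal_law (hm z) (h0 z) (hs z)]
    exact setIntegral_congr_fun (hs z) fun x hx => hz.eq_min_of_ne hx
  have hcompl : {x | zhat x ≠ 1} = {x | zhat x ≠ 0}ᶜ := by
    ext x
    simp only [mem_ofPred_eq, mem_compl_iff]
    lia
  rw [errorProb, Fin.sum_univ_two, herr, herr, hcompl]
  exact congrArg _ (integral_add_compl (hs 0) ((hi 0).inf (hi 1)))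

end Densities

section ChernoffCoefficient

variable {Ω : Type*} {φ : Fin 2 → Ω → ℝ}

/-- The (unnormalised) geometric mixture `φ₀^(1-α) φ₁^α`. -/
noncomputable def geomMix (φ : Fin 2 → Ω → ℝ) (α : ℝ) (x : Ω) : ℝ :=
  φ 0 x ^ (1 - α) * φ 1 x ^ α

/-- The log-likelihood ratio `log (φ₁ / φ₀)`. -/
noncomputable def logRatio (φ : Fin 2 → Ω → ℝ) (x : Ω) : ℝ :=
  Real.log (φ 1 x) - Real.log (φ 0 x)

lemma geomMix_nonneg (h0 : ∀ z x, 0 ≤ φ z x) (α : ℝ) (x : Ω) :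
    0 ≤ geomMix φ α x :=
  mul_nonneg (Real.rpow_nonneg (h0 0 x) _) (Real.rpow_nonneg (h0 1 x) _)

lemma norm_geomMix_le (h0 : ∀ z x, 0 ≤ φ z x) {α : ℝ} (hα : α ∈ Icc (0 : ℝ) 1) (x : Ω) :
    ‖geomMix φ α x‖ ≤ φ 0 x + φ 1 x := by
  rw [Real.norm_of_nonneg (geomMix_nonneg h0 α x)]
  calc geomMix φ α x ≤ (1 - α) * φ 0 x + α * φ 1 x :=
        Real.geom_mean_le_arith_mean2_weighted (sub_nonneg.2 hα.2) hα.1 (h0 0 x) (h0 1 x) (by ring)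
    _ ≤ φ 0 x + φ 1 x := add_le_add
        (mul_le_of_le_one_left (h0 0 x) (by linarith [hα.1])) (mul_le_of_le_one_left (h0 1 x) hα.2)

lemma eq_geomMix_mul_exp (h0 : ∀ z x, 0 ≤ φ z x) {x : Ω}
    (hx : φ 0 x = 0 ↔ φ 1 x = 0) (α : ℝ) :
    φ 0 x = geomMix φ α x * Real.exp (-α * logRatio φ x) ∧
      φ 1 x = geomMix φ α x * Real.exp ((1 - α) * logRatio φ x) := by
  rcases (h0 0 x).eq_or_lt with h | h
  · have h' := hx.1 h.symm
    rcases eq_or_ne α 0 with rfl | hα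
    · simp [geomMix, ← h, h']
    · simp [geomMix, ← h, h', Real.zero_rpow hα]
  · have h' : 0 < φ 1 x := (h0 1 x).lt_of_ne' fun h1 => h.ne' (hx.2 h1)
    rw [geomMix, logRatio, Real.rpow_def_of_pos h, Real.rpow_def_of_pos h', ← Real.exp_add,
      ← Real.exp_add, ← Real.exp_add]
    constructor
    · rw [← Real.exp_log h, Real.log_exp]
      congr 1
      ring
    · rw [← Real.exp_log h', Real.log_exp]
      congr 1
      ring

variable [MeasurableSpace Ω] {μ : Measure Ω}

/-- The Chernoff `α`-coefficient `∫ φ₀^(1-α) φ₁^α dμ`, whose negative logarithm is the Chernoff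
`α`-divergence. -/
noncomputable def chernoffCoeff (μ : Measure Ω) (φ : Fin 2 → Ω → ℝ) (α : ℝ) : ℝ :=
  ∫ x, geomMix φ α x ∂μ

lemma measurable_geomMix (hm : ∀ z, Measurable (φ z)) (α : ℝ) : Measurable (geomMix φ α) :=
  ((hm 0).pow_const _).mul ((hm 1).pow_const _)

lemma measurable_logRatio (hm : ∀ z, Measurable (φ z)) : Measurable (logRatio φ) :=
  (hm 1).log.sub (hm 0).log

lemma integrable_geomMix (hφ : ∀ z, IsDensity μ (φ z)) {α : ℝ} (hα : α ∈ Icc (0 : ℝ) 1) :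
    Integrable (geomMix φ α) μ :=
  ((hφ 0).integrable.add (hφ 1).integrable).mono'
    (measurable_geomMix (fun z => (hφ z).measurable) α).aestronglyMeasurable
    (ae_of_all _ (norm_geomMix_le (fun z => (hφ z).nonneg) hα))

lemma chernoffCoeff_zero (hφ : ∀ z, IsDensity μ (φ z)) : chernoffCoeff μ φ 0 = 1 := by
  simpa [chernoffCoeff, geomMix] using (hφ 0).integral_eq_one

lemma chernoffCoeff_one (hφ : ∀ z, IsDensity μ (φ z)) : chernoffCoeff μ φ 1 = 1 := by
  simpa [chernoffCoeff, geomMix] using (hφ 1).integral_eq_one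

lemma integral_sq_sqrt_sub_sqrt (hφ : ∀ z, IsDensity μ (φ z)) :
    ∫ x, (√(φ 0 x) - √(φ 1 x)) ^ 2 ∂μ = 2 - 2 * chernoffCoeff μ φ (1 / 2) := by
  have hexpand : ∀ x, (√(φ 0 x) - √(φ 1 x)) ^ 2 = φ 0 x + φ 1 x - 2 * geomMix φ (1 / 2) x :=
    fun x => by
    rw [geomMix, show (1 - 1 / 2 : ℝ) = 1 / 2 by norm_num, ← Real.sqrt_eq_rpow,
      ← Real.sqrt_eq_rpow, sub_sq, Real.sq_sqrt ((hφ 0).nonneg x), Real.sq_sqrt ((hφ 1).nonneg x)]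
    ring
  have hsum : Integrable (fun x => φ 0 x + φ 1 x) μ := (hφ 0).integrable.add (hφ 1).integrable
  simp only [hexpand]
  rw [integral_sub hsum ((integrable_geomMix hφ (by norm_num)).const_mul 2),
    integral_add (hφ 0).integrable (hφ 1).integrable, integral_const_mul,
    (hφ 0).integral_eq_one, (hφ 1).integral_eq_one, chernoffCoeff]
  norm_num

lemma chernoffCoeff_half_lt_one (hφ : ∀ z, IsDensity μ (φ z)) (hne : ¬ φ 0 =ᵐ[μ] φ 1) :
    chernoffCoeff μ φ (1 / 2) < 1 := by
  suffices 0 < ∫ x, (√(φ 0 x) - √(φ 1 x)) ^ 2 ∂μ by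
    rw [integral_sq_sqrt_sub_sqrt hφ] at this
    linarith
  have hint : Integrable (fun x => (√(φ 0 x) - √(φ 1 x)) ^ 2) μ := by
    refine ((hφ 0).integrable.add (hφ 1).integrable).mono' ?_ (ae_of_all _ fun x => ?_)
    · exact (((hφ 0).measurable.sqrt.sub (hφ 1).measurable.sqrt).pow_const 2).aestronglyMeasurable
    · rw [Real.norm_of_nonneg (sq_nonneg _), Pi.add_apply]
      nlinarith [Real.sq_sqrt ((hφ 0).nonneg x), Real.sq_sqrt ((hφ 1).nonneg x),
        Real.sqrt_nonneg (φ 0 x), Real.sqrt_nonneg (φ 1 x)]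
  refine (integral_nonneg fun x => sq_nonneg _).lt_of_ne' fun h => hne ?_
  filter_upwards [(integral_eq_zero_iff_of_nonneg (fun x => sq_nonneg _) hint).1 h] with x hx
  exact (Real.sqrt_inj ((hφ 0).nonneg x) ((hφ 1).nonneg x)).1 (sub_eq_zero.1 (sq_eq_zero_iff.1 hx))

lemma chernoffCoeff_pos (hφ : ∀ z, IsDensity μ (φ z)) (hac : ∀ᵐ x ∂μ, φ 0 x = 0 ↔ φ 1 x = 0)
    {α : ℝ} (hα : α ∈ Icc (0 : ℝ) 1) : 0 < chernoffCoeff μ φ α := by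
  have hnn := geomMix_nonneg (fun z => (hφ z).nonneg) α
  refine (integral_nonneg hnn).lt_of_ne' fun h => zero_ne_one' ℝ ?_
  rw [← (hφ 0).integral_eq_one, eq_comm]
  refine integral_eq_zero_of_ae ?_
  filter_upwards [(integral_eq_zero_iff_of_nonneg hnn (integrable_geomMix hφ hα)).1 h, hac]
    with x hx hiff
  rw [(eq_geomMix_mul_exp (fun z => (hφ z).nonneg) hiff α).1, hx, Pi.zero_apply, zero_mul]

lemma continuousOn_chernoffCoeff (hφ : ∀ z, IsDensity μ (φ z))
    (hac : ∀ᵐ x ∂μ, φ 0 x = 0 ↔ φ 1 x = 0) : ContinuousOn (chernoffCoeff μ φ) (Icc 0 1) := by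
  refine continuousOn_of_dominated (bound := fun x => φ 0 x + φ 1 x)
    (fun α _ => (measurable_geomMix (fun z => (hφ z).measurable) α).aestronglyMeasurable)
    (fun α hα => ae_of_all _ (norm_geomMix_le (fun z => (hφ z).nonneg) hα))
    ((hφ 0).integrable.add (hφ 1).integrable) ?_
  filter_upwards [hac] with x hx
  have hexp : ∀ α, geomMix φ α x = φ 0 x * Real.exp (α * logRatio φ x) := fun α => by
    rw [(eq_geomMix_mul_exp (fun z => (hφ z).nonneg) hx α).1, mul_assoc, ← Real.exp_add]
    simp
  simp only [hexp]
  fun_prop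

lemma exists_isMinOn_chernoffCoeff (hφ : ∀ z, IsDensity μ (φ z))
    (hac : ∀ᵐ x ∂μ, φ 0 x = 0 ↔ φ 1 x = 0) (hne : ¬ φ 0 =ᵐ[μ] φ 1) :
    ∃ α ∈ Ioo (0 : ℝ) 1, IsMinOn (chernoffCoeff μ φ) (Icc 0 1) α := by
  obtain ⟨α, hα, hmin⟩ := isCompact_Icc.exists_isMinOn (nonempty_Icc.2 zero_le_one)
    (continuousOn_chernoffCoeff hφ hac)
  have hlt : chernoffCoeff μ φ α < 1 :=
    (isMinOn_iff.1 hmin (1 / 2) (by norm_num)).trans_lt (chernoffCoeff_half_lt_one hφ hne)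
  refine ⟨α, ⟨hα.1.lt_of_ne ?_, hα.2.lt_of_ne ?_⟩, hmin⟩
  · rintro rfl
    exact hlt.ne (chernoffCoeff_zero hφ)
  · rintro rfl
    exact hlt.ne (chernoffCoeff_one hφ)

lemma chernoffInfo_eq_neg_log (hφ : ∀ z, IsDensity μ (φ z))
    (hac : ∀ᵐ x ∂μ, φ 0 x = 0 ↔ φ 1 x = 0) {α : ℝ} (hα : α ∈ Ioo (0 : ℝ) 1)
    (hmin : IsMinOn (chernoffCoeff μ φ) (Icc 0 1) α) :
    chernoffInfo μ φ = -Real.log (chernoffCoeff μ φ α) := by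
  have hle : ∀ β : Ioo (0 : ℝ) 1, chernoffDiv μ φ β ≤ -Real.log (chernoffCoeff μ φ α) := fun β =>
    neg_le_neg (Real.log_le_log (chernoffCoeff_pos hφ hac (Ioo_subset_Icc_self hα))
      (hmin (Ioo_subset_Icc_self β.2)))
  have : Nonempty (Ioo (0 : ℝ) 1) := ⟨⟨α, hα⟩⟩
  exact le_antisymm (ciSup_le hle) (le_ciSup (f := fun β : Ioo (0 : ℝ) 1 => chernoffDiv μ φ β)
    ⟨_, forall_mem_range.2 hle⟩ ⟨α, hα⟩)

end ChernoffCoefficient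

section Tilting

variable {Ω : Type*} [MeasurableSpace Ω] {μ : Measure Ω} {φ : Fin 2 → Ω → ℝ} {α : ℝ}

/-- The normalised geometric mixture, i.e. `φ₀` exponentially tilted by `α` times the
log-likelihood ratio. -/
noncomputable def tiltedDensity (μ : Measure Ω) (φ : Fin 2 → Ω → ℝ) (α : ℝ) (x : Ω) : ℝ :=
  geomMix φ α x / chernoffCoeff μ φ α

lemma isDensity_tiltedDensity (hφ : ∀ z, IsDensity μ (φ z))
    (hac : ∀ᵐ x ∂μ, φ 0 x = 0 ↔ φ 1 x = 0) (hα : α ∈ Icc (0 : ℝ) 1) :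
    IsDensity μ (tiltedDensity μ φ α) :=
  isDensity_div_integral (measurable_geomMix (fun z => (hφ z).measurable) α)
    (geomMix_nonneg (fun z => (hφ z).nonneg) α) (integrable_geomMix hφ hα)
    (chernoffCoeff_pos hφ hac hα)

lemma ae_eq_mul_tiltedDensity_mul_exp (hφ : ∀ z, IsDensity μ (φ z))
    (hac : ∀ᵐ x ∂μ, φ 0 x = 0 ↔ φ 1 x = 0) (hα : α ∈ Icc (0 : ℝ) 1) :
    ∀ᵐ x ∂μ,
      φ 0 x = chernoffCoeff μ φ α * tiltedDensity μ φ α x * Real.exp (-α * logRatio φ x) ∧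
      φ 1 x = chernoffCoeff μ φ α * tiltedDensity μ φ α x * Real.exp ((1 - α) * logRatio φ x) := by
  filter_upwards [hac] with x hx
  rw [tiltedDensity, mul_div_cancel₀ _ (chernoffCoeff_pos hφ hac hα).ne']
  exact eq_geomMix_mul_exp (fun z => (hφ z).nonneg) hx α

lemma ae_mul_exp_logRatio (hφ : ∀ z, IsDensity μ (φ z))
    (hac : ∀ᵐ x ∂μ, φ 0 x = 0 ↔ φ 1 x = 0) (α : ℝ) :
    (fun x => φ 0 x * Real.exp (α * logRatio φ x)) =ᵐ[μ] geomMix φ α := by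
  filter_upwards [hac] with x hx
  rw [(eq_geomMix_mul_exp (fun z => (hφ z).nonneg) hx α).1, mul_assoc, ← Real.exp_add, neg_mul,
    neg_add_cancel, Real.exp_zero, mul_one]

lemma mgf_logRatio (hφ : ∀ z, IsDensity μ (φ z)) (hac : ∀ᵐ x ∂μ, φ 0 x = 0 ↔ φ 1 x = 0) :
    ProbabilityTheory.mgf (logRatio φ) (law μ (φ 0)) = chernoffCoeff μ φ := by
  ext α
  rw [ProbabilityTheory.mgf, integral_law (hφ 0).measurable (hφ 0).nonneg]
  exact integral_congr_ae (ae_mul_exp_logRatio hφ hac α)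

lemma mem_interior_integrableExpSet_logRatio (hφ : ∀ z, IsDensity μ (φ z))
    (hac : ∀ᵐ x ∂μ, φ 0 x = 0 ↔ φ 1 x = 0) (hα : α ∈ Ioo (0 : ℝ) 1) :
    α ∈ interior (ProbabilityTheory.integrableExpSet (logRatio φ) (law μ (φ 0))) :=
  interior_maximal (fun β hβ => (integrable_law_iff (hφ 0).measurable (hφ 0).nonneg).2
    ((integrable_geomMix hφ (Ioo_subset_Icc_self hβ)).congr
      (ae_mul_exp_logRatio hφ hac β).symm)) isOpen_Ioo hα

lemma law_tiltedDensity (hφ : ∀ z, IsDensity μ (φ z)) (hac : ∀ᵐ x ∂μ, φ 0 x = 0 ↔ φ 1 x = 0)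
    (α : ℝ) :
    law μ (tiltedDensity μ φ α) = (law μ (φ 0)).tilted fun x => α * logRatio φ x := by
  have hX := measurable_logRatio fun z => (hφ z).measurable
  have hm := (hφ 0).measurable
  have hnorm : ∫ x, Real.exp (α * logRatio φ x) ∂law μ (φ 0) = chernoffCoeff μ φ α :=
    congrFun (mgf_logRatio hφ hac) α
  rw [Measure.tilted, hnorm, law, law, ← withDensity_mul _ (by fun_prop) (by fun_prop)]
  refine withDensity_congr_ae ((ae_mul_exp_logRatio hφ hac α).mono fun x hx => ?_)
  rw [Pi.mul_apply, ← ENNReal.ofReal_mul ((hφ 0).nonneg x), ← mul_div_assoc]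
  exact congrArg (fun r => ENNReal.ofReal (r / _)) hx.symm

lemma integral_logRatio_tiltedDensity_eq_zero (hφ : ∀ z, IsDensity μ (φ z))
    (hac : ∀ᵐ x ∂μ, φ 0 x = 0 ↔ φ 1 x = 0) (hα : α ∈ Ioo (0 : ℝ) 1)
    (hmin : IsMinOn (chernoffCoeff μ φ) (Icc 0 1) α) :
    ∫ x, logRatio φ x ∂law μ (tiltedDensity μ φ α) = 0 := by
  have hint := mem_interior_integrableExpSet_logRatio hφ hac hα
  rw [law_tiltedDensity hφ hac, ProbabilityTheory.integral_tilted_mul_self hint,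
    ProbabilityTheory.deriv_cgf hint, ← ProbabilityTheory.deriv_mgf hint, mgf_logRatio hφ hac,
    (hmin.isLocalMin (Icc_mem_nhds hα.1 hα.2)).deriv_eq_zero, zero_div]

lemma integral_logRatio_sq_tiltedDensity_pos (hφ : ∀ z, IsDensity μ (φ z))
    (hac : ∀ᵐ x ∂μ, φ 0 x = 0 ↔ φ 1 x = 0) (hne : ¬ φ 0 =ᵐ[μ] φ 1) (hα : α ∈ Ioo (0 : ℝ) 1) :
    0 < ∫ x, logRatio φ x ^ 2 ∂law μ (tiltedDensity μ φ α) := by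
  have hα' := Ioo_subset_Icc_self hα
  have hq := isDensity_tiltedDensity hφ hac hα'
  have hint : Integrable (fun x => logRatio φ x ^ 2) (law μ (tiltedDensity μ φ α)) := by
    rw [law_tiltedDensity hφ hac]
    exact (ProbabilityTheory.memLp_tilted_mul
      (mem_interior_integrableExpSet_logRatio hφ hac hα) 2).integrable_sq
  rw [integrable_law_iff hq.measurable hq.nonneg] at hint
  have hnn : ∀ x, 0 ≤ tiltedDensity μ φ α x * logRatio φ x ^ 2 := fun x =>
    mul_nonneg (hq.nonneg x) (sq_nonneg _)
  rw [integral_law hq.measurable hq.nonneg]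
  refine (integral_nonneg hnn).lt_of_ne' fun h => hne ?_
  filter_upwards [(integral_eq_zero_iff_of_nonneg hnn hint).1 h,
    ae_eq_mul_tiltedDensity_mul_exp hφ hac hα'] with x hx ⟨h0, h1⟩
  rw [h0, h1]
  rcases mul_eq_zero.1 hx with hx | hx
  · rw [hx, mul_zero, zero_mul, zero_mul]
  · rw [sq_eq_zero_iff.1 hx, mul_zero, mul_zero]

end Tilting

section Affinity

variable {Ω : Type*} {φ : Fin 2 → Ω → ℝ}

lemma iidDensity_eq_of_forall {f q X : Ω → ℝ} {Z c : ℝ} {n : ℕ} {x : Fin n → Ω}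
    (h : ∀ j, f (x j) = Z * q (x j) * Real.exp (c * X (x j))) :
    iidDensity n f x = iidDensity n q x * (Z ^ n * Real.exp (c * ∑ j, X (x j))) := by
  simp only [iidDensity, h, Finset.prod_mul_distrib, Finset.prod_const, Finset.card_univ,
    Fintype.card_fin, Finset.mul_sum, Real.exp_sum]
  ring

lemma affinity_iidDensity_eq [MeasurableSpace Ω] {μ : Measure Ω} [SigmaFinite μ] {q X : Ω → ℝ}
    (hq : IsDensity μ q) {Z a b : ℝ} (hZ : 0 ≤ Z)
    (h : ∀ᵐ x ∂μ, φ 0 x = Z * q x * Real.exp (a * X x) ∧ φ 1 x = Z * q x * Real.exp (b * X x))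
    (n : ℕ) :
    affinity (Measure.pi fun _ : Fin n => μ) (fun z => iidDensity n (φ z))
      = Z ^ n * ∫ x, min (Real.exp (a * ∑ j, X (x j))) (Real.exp (b * ∑ j, X (x j)))
          ∂(Measure.pi fun _ : Fin n => law μ q) := by
  rw [pi_law hq, integral_law (measurable_iidDensity hq.measurable n)
    (iidDensity_nonneg hq.nonneg n), ← integral_const_mul]
  refine integral_congr_ae ?_
  filter_upwards [eventually_all.2 fun j => (Measure.tendsto_eval_ae_ae (i := j)).eventually h]
    with x hx
  rw [iidDensity_eq_of_forall fun j => (hx j).1, iidDensity_eq_of_forall fun j => (hx j).2,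
    ← mul_min_of_nonneg _ _ (iidDensity_nonneg hq.nonneg n x),
    ← mul_min_of_nonneg _ _ (pow_nonneg hZ n), mul_left_comm]

lemma exp_neg_mul_abs_isBigO {c : ℝ} (hc : 0 < c) :
    (fun s : ℝ => Real.exp (-(c * |s|))) =O[⊤] fun s => (1 + s ^ 2)⁻¹ := by
  refine isBigO_top.2 ⟨1 + 2 / c ^ 2, fun s => ?_⟩
  rw [Real.norm_of_nonneg (Real.exp_pos _).le, Real.norm_of_nonneg (by positivity), Real.exp_neg,
    ← div_eq_mul_inv, le_div_iff₀ (by positivity), inv_mul_le_iff₀ (Real.exp_pos _)]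
  have hquad := Real.quadratic_le_exp_of_nonneg (mul_nonneg hc.le (abs_nonneg s))
  rw [mul_pow, sq_abs] at hquad
  calc 1 + s ^ 2 ≤ (1 + c ^ 2 * s ^ 2 / 2) * (1 + 2 / c ^ 2) := by
        field_simp
        nlinarith [sq_nonneg (c ^ 2 * s), sq_nonneg c]
    _ ≤ Real.exp (c * |s|) * (1 + 2 / c ^ 2) := by
        gcongr
        linarith [mul_nonneg hc.le (abs_nonneg s)]

lemma min_exp_mul_isBigO {a b : ℝ} (ha : a < 0) (hb : 0 < b) :
    (fun s : ℝ => min (Real.exp (a * s)) (Real.exp (b * s))) =O[⊤] fun s => (1 + s ^ 2)⁻¹ := by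
  refine IsBigO.trans (isBigO_top.2 ⟨1, fun s => ?_⟩)
    (exp_neg_mul_abs_isBigO (lt_min (neg_pos.2 ha) hb))
  rw [one_mul, Real.norm_of_nonneg (le_min (Real.exp_pos _).le (Real.exp_pos _).le),
    Real.norm_of_nonneg (Real.exp_pos _).le]
  rcases le_total 0 s with hs | hs
  · refine (min_le_left _ _).trans (Real.exp_le_exp.2 ?_)
    rw [abs_of_nonneg hs]
    nlinarith [min_le_left (-a) b]
  · refine (min_le_right _ _).trans (Real.exp_le_exp.2 ?_)
    rw [abs_of_nonpos hs]
    nlinarith [min_le_right (-a) b]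

theorem affinity_iidDensity_isTheta [MeasurableSpace Ω] {μ : Measure Ω} [SigmaFinite μ]
    (hφ : ∀ z, IsDensity μ (φ z)) (hac : ∀ᵐ x ∂μ, φ 0 x = 0 ↔ φ 1 x = 0)
    (hne : ¬ φ 0 =ᵐ[μ] φ 1) :
    (fun n : ℕ => affinity (Measure.pi fun _ : Fin n => μ) (fun z => iidDensity n (φ z)))
      =Θ[atTop] fun n : ℕ => 1 / √(n : ℝ) * Real.exp (-(n * chernoffInfo μ φ)) := by
  obtain ⟨α, hα, hmin⟩ := exists_isMinOn_chernoffCoeff hφ hac hne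
  have hα' := Ioo_subset_Icc_self hα
  have hZ := chernoffCoeff_pos hφ hac hα'
  have hq := isDensity_tiltedDensity hφ hac hα'
  have := hq.isProbabilityMeasure_law
  have hexp : ∀ n : ℕ, Real.exp (-(n * chernoffInfo μ φ)) = chernoffCoeff μ φ α ^ n := fun n => by
    rw [chernoffInfo_eq_neg_log hφ hac hα hmin, mul_neg, neg_neg, Real.exp_nat_mul,
      Real.exp_log hZ]
  simp only [hexp, mul_comm (1 / √_),
    affinity_iidDensity_eq hq hZ.le (ae_eq_mul_tiltedDensity_mul_exp hφ hac hα')]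
  exact (isTheta_refl _ _).mul (integral_sum_pi_isTheta_inv_sqrt
    (g := fun s => min (Real.exp (-α * s)) (Real.exp ((1 - α) * s)))
    (measurable_logRatio fun z => (hφ z).measurable)
    (integral_logRatio_tiltedDensity_eq_zero hφ hac hα hmin)
    (integral_logRatio_sq_tiltedDensity_pos hφ hac hne hα) (by fun_prop)
    (fun s => lt_min (Real.exp_pos _) (Real.exp_pos _))
    (min_exp_mul_isBigO (neg_lt_zero.2 hα.1) (sub_pos.2 hα.2)))

end Affinity

lemma log_sub_log_isBigO_one_of_isTheta {ι : Type*} {l : Filter ι} {u v : ι → ℝ} (h : u =Θ[l] v) :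
    (fun i => Real.log (u i) - Real.log (v i)) =O[l] fun _ => (1 : ℝ) := by
  obtain ⟨c, hc, hle⟩ := h.1.exists_pos
  obtain ⟨d, hd, hge⟩ := h.2.exists_pos
  refine .of_bound (|Real.log c| + |Real.log d|) ?_
  filter_upwards [hle.bound, hge.bound] with i huv hvu
  rw [norm_one, mul_one]
  by_cases hu : u i = 0
  · have hv : v i = 0 := norm_le_zero_iff.1 (by simpa [hu] using hvu)
    rw [hu, hv, sub_self, norm_zero]
    positivity
  · have hv : v i ≠ 0 := fun hv => hu (norm_le_zero_iff.1 (by simpa [hv] using huv))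
    have hlogu := Real.log_le_log (norm_pos_iff.2 hu) huv
    have hlogv := Real.log_le_log (norm_pos_iff.2 hv) hvu
    rw [Real.log_mul hc.ne' (norm_ne_zero_iff.2 hv)] at hlogu
    rw [Real.log_mul hd.ne' (norm_ne_zero_iff.2 hu)] at hlogv
    simp only [Real.norm_eq_abs, Real.log_abs] at hlogu hlogv ⊢
    exact abs_le.2 ⟨by linarith [le_abs_self (Real.log d), abs_nonneg (Real.log c)],
      by linarith [le_abs_self (Real.log c), abs_nonneg (Real.log d)]⟩

lemma log_sub_isBigO_one_of_isTheta_inv_sqrt_mul_exp {u : ℕ → ℝ} {D : ℝ}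
    (h : u =Θ[atTop] fun n : ℕ => 1 / √(n : ℝ) * Real.exp (-(n * D))) :
    (fun n : ℕ => Real.log (u n) - (-(n * D) - 1 / 2 * Real.log n)) =O[atTop] fun _ => (1 : ℝ) := by
  refine (log_sub_log_isBigO_one_of_isTheta h).congr' ?_ .rfl
  filter_upwards [eventually_gt_atTop 0] with n hn
  have hn' : (0 : ℝ) < n := Nat.cast_pos.2 hn
  rw [Real.log_mul (by positivity) (Real.exp_pos _).ne', Real.log_exp, one_div, Real.log_inv,
    Real.log_sqrt hn'.le]
  ring

end BayesChernoff

open BayesChernoff in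
theorem mainTheorem2_general {Ω : Type*} [MeasurableSpace Ω] (μ : Measure Ω) [SigmaFinite μ]
    (φ : Fin 2 → Ω → ℝ) (hφ : ∀ z, IsDensity μ (φ z)) (h01 : law μ (φ 0) ≪ law μ (φ 1))
    (h10 : law μ (φ 1) ≪ law μ (φ 0)) (hne : law μ (φ 0) ≠ law μ (φ 1)) :
    ((fun n : ℕ => affinity (Measure.pi fun _ : Fin n => μ) (fun z => iidDensity n (φ z)))
      =Θ[atTop] fun n : ℕ => 1 / √(n : ℝ) * Real.exp (-(n * chernoffInfo μ φ))) ∧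
    ((fun n : ℕ =>
        Real.log (affinity (Measure.pi fun _ : Fin n => μ) (fun z => iidDensity n (φ z)))
          - (-(n * chernoffInfo μ φ) - 1 / 2 * Real.log n))
      =O[atTop] fun _ => (1 : ℝ)) ∧
    ∀ zhat : (n : ℕ) → (Fin n → Ω) → Fin 2,
      (∀ n, IsBayesEstimator (fun z => iidDensity n (φ z)) (zhat n)) →
      (fun n : ℕ =>
        Real.log (errorProb (Measure.pi fun _ : Fin n => μ) (fun z => iidDensity n (φ z)) (zhat n))
          - (-(n * chernoffInfo μ φ) - 1 / 2 * Real.log n))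
      =O[atTop] fun _ => (1 : ℝ) := by
  have hac := ae_eq_zero_iff_of_law_absolutelyContinuous (fun z => (hφ z).measurable)
    (fun z => (hφ z).nonneg) h01 h10
  have haff := affinity_iidDensity_isTheta hφ hac fun h => hne (law_congr_ae h)
  refine ⟨haff, log_sub_isBigO_one_of_isTheta_inv_sqrt_mul_exp haff, fun zhat hz => ?_⟩
  have herr : ∀ n,
      errorProb (Measure.pi fun _ : Fin n => μ) (fun z => iidDensity n (φ z)) (zhat n)
        = 1 / 2 * affinity (Measure.pi fun _ : Fin n => μ) (fun z => iidDensity n (φ z)) :=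
    fun n => errorProb_eq_half_mul_affinity (fun z => measurable_iidDensity (hφ z).measurable n)
      (fun z => iidDensity_nonneg (hφ z).nonneg n)
      (fun z => integrable_iidDensity (hφ z).integrable n) (hz n)
  simp only [herr]
  exact log_sub_isBigO_one_of_isTheta_inv_sqrt_mul_exp (haff.const_mul_left (by norm_num))

open BayesChernoff in
theorem mainTheorem2 {Ω : Type*} [MeasurableSpace Ω] (μ : Measure Ω) [SigmaFinite μ]
    (φ : Fin 2 → Ω → ℝ) (hφ : IsAdmissible μ φ) :
    ((fun n : ℕ => affinity (Measure.pi fun _ : Fin n => μ) (fun z => iidDensity n (φ z)))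
      =Θ[atTop] fun n : ℕ => 1 / √(n : ℝ) * Real.exp (-(n * chernoffInfo μ φ))) ∧
    ((fun n : ℕ =>
        Real.log (affinity (Measure.pi fun _ : Fin n => μ) (fun z => iidDensity n (φ z)))
          - (-(n * chernoffInfo μ φ) - 1 / 2 * Real.log n))
      =O[atTop] fun _ => (1 : ℝ)) ∧
    ∀ zhat : (n : ℕ) → (Fin n → Ω) → Fin 2,
      (∀ n, IsBayesEstimator (fun z => iidDensity n (φ z)) (zhat n)) →
      (fun n : ℕ =>
        Real.log (errorProb (Measure.pi fun _ : Fin n => μ) (fun z => iidDensity n (φ z)) (zhat n))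
          - (-(n * chernoffInfo μ φ) - 1 / 2 * Real.log n))
      =O[atTop] fun _ => (1 : ℝ) := by
  exact mainTheorem2_general μ φ hφ.isDensity
    (InformationTheory.klDiv_ne_top_iff.1 hφ.kl_lt_top.ne).1
    (InformationTheory.klDiv_ne_top_iff.1 hφ.kl_lt_top'.ne).1 hφ.law_ne
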